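/- **Setting.** Let $A$ be a finite-dimensional real alternative (not necessarily associative) algebra with unity $1\ne 0$, with $\mathbb R$ identified with $\mathbb R\cdot 1\subset A$, equipped with a real-linear anti-involution $x\mapsto x^c$. Put $t(x)=x+x^c$ and $n(x)=xx^c$, and let $$\mathcal Q_A=\mathbb R\cup\{x\in A : t(x)\in\mathbb R,\ n(x)\in\mathbb R,\ 4n(x)>t(x)^2\},\qquad \mathbb S_A=\{J\in\mathcal Q_A : J^2=-1\}.$$ Assume that $A$ carries a norm $\|\cdot\|_A$ such that $\|x\|_A=\sqrt{n(x)}$ for every $x\in\mathcal Q_A$. Let $D\subset\mathbb C$ be open and invariant under complex conjugation, and let $$\Omega_D=\{\alpha+\beta J : \alpha,\beta\in\mathbb R,\ \alpha+i\beta\in D,\ J\in\mathbb S_A\}\subset\mathcal Q_A .$$ A *stem function* on $D$ is a map $F=F_1+iF_2:D\to A\otimes_{\mathbb R}\mathbb C$ ($F_1,F_2$ with values in $A$) with $F(\bar z)=\overline{F(z)}$. It induces the *slice function* $\mathcal I(F):\Omega_D\to A$, $\mathcal I(F)(\alpha+\beta J)=F_1(\alpha+i\beta)+J\,F_2(\alpha+i\beta)$.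 A function on $\Omega_D$ is *slice regular* if it equals $\mathcal I(F)$ for a stem function $F$ of class $\mathscr C^1$ with $\partial F/\partial\bar z=\frac12\left(\partial F/\partial\alpha+i\,\partial F/\partial\beta\right)=0$ on $D$. For $y\in\mathcal Q_A$ put $\Delta_y(z)=(z-y)(z-y^c)$, computed in $A\otimes_{\mathbb R}\mathbb C$ for $z\in\mathbb C$, and $$S_{y,2m}(z)=\Delta_y(z)^m,\qquad S_{y,2m+1}(z)=\Delta_y(z)^m(z-y)\qquad(m\in\mathbb N).$$ For $s\in A$ let $S_{y,n}(x)\,s$ denote the value at $x$ of the slice function induced by the stem function $z\mapsto S_{y,n}(z)\,s$ (explicitly, $\Delta_y(x)^m s$ if $n=2m$ and $\Delta_y(x)^m((x-y)s)$ if $n=2m+1$, where $\Delta_y(x)=x^2-x\,t(y)+n(y)$). The *Cassini pseudo-metric* on $\mathcal Q_A$ is $\mathfrak u_A(x,y)=\sqrt{\|\Delta_y(x)\|_A}$. A function $f:\Omega_D\to A$ is *spherically analytic* if for each $y\in\Omega_D$ there are $r>0$ with $U=\{x\in\mathcal Q_A : \mathfrak u_A(x,y)<r\}\subset\Omega_D$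 and a sequence $(s_n)_{n\in\mathbb N}$ in $A$ such that $\sum_{n\in\mathbb N}S_{y,n}(x)\,s_n$ converges to $f(x)$ for every $x\in U$. **Theorem.** Let $\Omega_D$ be (non-empty and) connected and let $f:\Omega_D\to A$ be any function. (i) If $D\cap\mathbb R=\emptyset$, then $f$ is slice regular if and only if $f$ is a slice function and is spherically analytic. (ii) If $D\cap\mathbb R\neq\emptyset$, then $f$ is slice regular if and only if $f$ is spherically analytic. -/

import Mathlib

open Filter Topology

namespace SliceReg

/-- A unital, not necessarily associative ring whose additive group carries a norm. No relation
between the norm and the multiplication is required here. -/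
class NormedNonAssocRing (A : Type*) extends NormedAddCommGroup A, NonAssocRing A

/-- The left and right alternative laws. -/
def IsAlternative (A : Type*) [Mul A] : Prop :=
  ∀ x y : A, (x * x) * y = x * (x * y) ∧ (y * x) * x = y * (x * x)

/-! ### The complexification `A ⊗ ℂ` -/

/-- Elements `re + i im` of `A ⊗ ℂ`, with `re`, `im` in `A`. -/
@[ext]
structure Complexification (A : Type*) where
  re : A
  im : A

namespace Complexification

variable {A : Type*} [NonAssocRing A]

instance : One (Complexification A) := ⟨⟨1, 0⟩⟩

instance : Mul (Complexification A) :=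
  ⟨fun w v => ⟨w.re * v.re - w.im * v.im, w.re * v.im + w.im * v.re⟩⟩

instance : Sub (Complexification A) := ⟨fun w v => ⟨w.re - v.re, w.im - v.im⟩⟩

/-- The embedding `a ↦ a ⊗ 1`. -/
def ofAlg (a : A) : Complexification A := ⟨a, 0⟩

/-- The embedding `z ↦ 1 ⊗ z`. -/
def ofComplex [Module ℝ A] (z : ℂ) : Complexification A := ⟨z.re • 1, z.im • 1⟩

/-- Complex conjugation `x + i y ↦ x - i y`. -/
def conj (w : Complexification A) : Complexification A := ⟨w.re, -w.im⟩

/-- Powers, `w ^ (m + 1) = w ^ m * w`. -/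
def pow (w : Complexification A) : ℕ → Complexification A
  | 0 => 1
  | m + 1 => pow w m * w

end Complexification

section

variable (A : Type*) [NormedNonAssocRing A] [NormedSpace ℝ A] [StarRing A]

/-- The quadratic cone: the multiples of `1`, and the `x` whose trace `t = x + xᶜ` and squared norm
`n = x xᶜ` are real with `4 n > t ^ 2`. The anti-involution is written `star`. -/
def quadraticCone : Set A :=
  {x | (∃ r : ℝ, x = r • (1 : A)) ∨
    ∃ t n : ℝ, x + star x = t • (1 : A) ∧ x * star x = n • (1 : A) ∧ t ^ 2 < 4 * n}

/-- The square roots of `-1` in the quadratic cone. -/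
def imagUnits : Set A := {J | J ∈ quadraticCone A ∧ J * J = -1}

/-- The norm satisfies `‖x‖ = √(n x)` on the quadratic cone. -/
def NormOnCone : Prop :=
  ∀ x ∈ quadraticCone A, ∀ r : ℝ, x * star x = r • (1 : A) → ‖x‖ = √r

/-- The circular set `O_D`. -/
def circ (D : Set ℂ) : Set A :=
  {x | x ∈ quadraticCone A ∧ ∃ (z : ℂ) (J : A), z ∈ D ∧ J ∈ imagUnits A ∧
    x = z.re • (1 : A) + z.im • J}

end

section

variable {A : Type*} [NormedNonAssocRing A] [NormedSpace ℝ A] [StarRing A]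

/-! ### Stem functions and slice functions -/

/-- `F` is a stem function on `D`. -/
def IsStem (D : Set ℂ) (F : ℂ → Complexification A) : Prop :=
  ∀ z ∈ D, F (starRingEnd ℂ z) = (F z).conj

open Classical in
/-- The slice function `I(F)`: its value at `x = α + β J` is `F₁(z) + J F₂(z)` with `z = α + i β`.
For a stem function the value does not depend on the representation of `x`
(see `sliceFun_apply`). -/
noncomputable def sliceFun (F : ℂ → Complexification A) (x : A) : A :=
  if h : ∃ p : ℂ × A, p.2 ∈ imagUnits A ∧ x = p.1.re • (1 : A) + p.1.im • p.2 then
    (F h.choose.1).re + h.choose.2 * (F h.choose.1).im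
  else 0

/-- `f` is a slice function on `O_D`: it is induced by some stem function on `D`. -/
def IsSlice (D : Set ℂ) (f : circ A D → A) : Prop :=
  ∃ F : ℂ → Complexification A, IsStem D F ∧ ∀ x : circ A D, f x = sliceFun F x

/-- `∂F/∂z̄ = (1/2) (∂F/∂α + i ∂F/∂β)`, for `F = F₁ + i F₂` and `z = α + i β`. -/
noncomputable def dbar (F : ℂ → Complexification A) (z : ℂ) : Complexification A :=
  ⟨(1 / 2 : ℝ) • (fderiv ℝ (fun ζ => (F ζ).re) z 1 - fderiv ℝ (fun ζ => (F ζ).im) z Complex.I),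
   (1 / 2 : ℝ) • (fderiv ℝ (fun ζ => (F ζ).im) z 1 + fderiv ℝ (fun ζ => (F ζ).re) z Complex.I)⟩

/-- `f` is slice regular on `O_D` (for `D` open): it is induced by a stem function of class `C¹`
with `∂F/∂z̄ = 0` on `D`, that is, by a holomorphic stem function. -/
def IsSliceRegular (D : Set ℂ) (f : circ A D → A) : Prop :=
  ∃ F : ℂ → Complexification A, IsStem D F ∧
    ContDiffOn ℝ 1 (fun z => (F z).re) D ∧ ContDiffOn ℝ 1 (fun z => (F z).im) D ∧
    (∀ z ∈ D, (dbar F z).re = 0 ∧ (dbar F z).im = 0) ∧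
    ∀ x : circ A D, f x = sliceFun F x

/-! ### Spherical series and the Cassini pseudo-metric -/

/-- The stem function `z ↦ z - y`. -/
noncomputable def linStem (y : A) (z : ℂ) : Complexification A :=
  Complexification.ofComplex z - Complexification.ofAlg y

/-- The stem function `Δ_y(z) = (z - y) (z - yᶜ)`. -/
noncomputable def charStem (y : A) (z : ℂ) : Complexification A :=
  linStem y z * linStem (star y) z

/-- The stem function of the spherical polynomial `S_{y,n}`:
`Δ_y ^ m` for `n = 2 m`, and `Δ_y ^ m (z - y)` for `n = 2 m + 1`. -/
noncomputable def sphStem (y : A) (n : ℕ) (z : ℂ) : Complexification A :=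
  if Even n then (charStem y z).pow (n / 2) else (charStem y z).pow (n / 2) * linStem y z

/-- The term `S_{y,n} · s` of a spherical series: the slice product of `S_{y,n}` with the constant
`s`, which is induced by the stem function `z ↦ S_{y,n}(z) s`. -/
noncomputable def sphTerm (y : A) (n : ℕ) (s : A) : A → A :=
  sliceFun fun z => sphStem y n z * Complexification.ofAlg s

/-- The Cassini pseudo-metric `√‖Δ_y(x)‖`, where `Δ_y(x) = x² - x t(y) + n(y)`. -/
noncomputable def cassini (x y : A) : ℝ :=
  √‖x * x - x * (y + star y) + y * star y‖

/-- The ball of the Cassini pseudo-metric on the quadratic cone. -/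
def cassiniBall (y : A) (r : ℝ) : Set A := {x | x ∈ quadraticCone A ∧ cassini x y < r}

/-- `f` is spherically analytic on `O_D`: around each `y` it is the sum of a spherical series on
some Cassini ball contained in `O_D`. Sums are limits of partial sums. -/
def IsSphericallyAnalytic (D : Set ℂ) (f : circ A D → A) : Prop :=
  ∀ y : circ A D, ∃ r : ℝ, 0 < r ∧ cassiniBall (y : A) r ⊆ circ A D ∧
    ∃ s : ℕ → A, ∀ x : circ A D, (x : A) ∈ cassiniBall (y : A) r →
      Tendsto (fun N => ∑ n ∈ Finset.range N, sphTerm (y : A) n (s n) x) atTop (𝓝 (f x))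

end

/-! ### The value of an induced function is independent of the representation of the point -/

theorem smul_one_inj {A : Type*} [NormedNonAssocRing A] [NormedSpace ℝ A] [Nontrivial A]
    {r s : ℝ} (h : r • (1 : A) = s • (1 : A)) : r = s :=
  smul_left_injective ℝ (one_ne_zero (α := A)) h

theorem star_imagUnit {A : Type*} [NormedNonAssocRing A] [NormedSpace ℝ A] [IsScalarTower ℝ A A]
    [SMulCommClass ℝ A A] [StarRing A] [Nontrivial A] {J : A} (hJ : J ∈ imagUnits A) : star J = -J := by
  obtain ⟨hQ, hJ2⟩ := hJ
  have key : ∀ a : ℝ, J ≠ a • (1 : A) := by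
    rintro a rfl
    have h : (a * a) • (1 : A) = (-1 : ℝ) • (1 : A) := by
      rw [neg_smul, one_smul, ← hJ2, smul_mul_smul_comm, mul_one]
    have := smul_one_inj h
    nlinarith [mul_self_nonneg a]
  rcases hQ with ⟨a, ha⟩ | ⟨t, n, ht, hn, -⟩
  · exact (key a ha).elim
  · have hs : star J = t • (1 : A) - J := by rw [← ht]; abel
    rw [hs, mul_sub, mul_smul_comm, mul_one, hJ2, sub_neg_eq_add] at hn
    have h1 : t • J = (n - 1) • (1 : A) := by
      rw [sub_smul, one_smul, ← hn]; abel
    have ht0 : t = 0 := by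
      by_contra h0
      apply key (t⁻¹ * (n - 1))
      rw [mul_smul, ← h1, smul_smul, inv_mul_cancel₀ h0, one_smul]
    rw [hs, ht0, zero_smul, zero_sub]

section

variable {A : Type*} [NormedNonAssocRing A] [NormedSpace ℝ A] [IsScalarTower ℝ A A]
  [SMulCommClass ℝ A A] [StarRing A] [StarModule ℝ A] [Nontrivial A]

theorem sliceFun_apply {D : Set ℂ} {F : ℂ → Complexification A} (hF : IsStem D F) {z : ℂ} (hz : z ∈ D) {J : A}
    (hJ : J ∈ imagUnits A) :
    sliceFun F (z.re • (1 : A) + z.im • J) = (F z).re + J * (F z).im := by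
  have h : ∃ p : ℂ × A, p.2 ∈ imagUnits A ∧
      z.re • (1 : A) + z.im • J = p.1.re • (1 : A) + p.1.im • p.2 := ⟨(z, J), hJ, rfl⟩
  rw [sliceFun, dif_pos h]
  obtain ⟨hK, e⟩ := h.choose_spec
  generalize h.choose = p at hK e ⊢
  obtain ⟨w, K⟩ := p
  simp only at hK e ⊢
  have e' := congrArg star e
  simp only [star_add, star_smul, star_one, star_imagUnit hJ, star_imagUnit hK, star_trivial,
    smul_neg] at e'
  have hre : z.re = w.re := by
    have h2 : (2 * z.re) • (1 : A) = (2 * w.re) • (1 : A) := by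
      have := congrArg₂ (· + ·) e e'
      rw [two_mul, two_mul, add_smul, add_smul]
      calc _ = z.re • (1 : A) + z.im • J + (z.re • 1 + -(z.im • J)) := by abel
        _ = _ := this
        _ = _ := by abel
    linarith [smul_one_inj h2]
  have him : z.im • J = w.im • K := by rw [hre] at e; exact add_left_cancel e
  have hsq : z.im * z.im = w.im * w.im := by
    have := congrArg (fun a => a * a) him
    simp only [smul_mul_smul_comm, hJ.2, hK.2, smul_neg, neg_inj] at this
    exact smul_one_inj this
  have real : z.im = 0 → (F z).im = 0 := by
    intro h0
    have hc : starRingEnd ℂ z = z := Complex.conj_eq_iff_im.2 h0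
    have h1 := congrArg Complexification.im (hF z hz)
    rw [hc] at h1
    simp only [Complexification.conj] at h1
    have h2 : (2 : ℝ) • (F z).im = 0 := by
      rw [two_smul]; nth_rewrite 1 [h1]; exact neg_add_cancel _
    exact (smul_eq_zero.1 h2).resolve_left two_ne_zero
  rcases mul_self_eq_mul_self_iff.1 hsq with h1 | h1
  · have hw : w = z := Complex.ext hre.symm h1.symm
    subst hw
    by_cases h0 : w.im = 0
    · rw [real h0, mul_zero, mul_zero]
    · rw [smul_right_injective A h0 him]
  · have hw : w = starRingEnd ℂ z := by
      apply Complex.ext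
      · simp [hre]
      · simp [h1]
    subst hw
    rw [hF z hz]
    simp only [Complexification.conj]
    by_cases h0 : z.im = 0
    · rw [real h0, mul_zero, neg_zero, mul_zero]
    · have hJK : J = -K := by
        apply smul_right_injective A h0
        simp only
        rw [him, Complex.conj_im, neg_smul, smul_neg]
      rw [hJK, mul_neg, neg_mul]

end

end SliceReg

open SliceReg

/-!
A point `x = α + β I` of the quadratic cone satisfies `Δ_y(x) = p + q I`, where `p + i q` is the value
at `z = α + i β` of the real polynomial `Δ_w(z) = (z - w) (z - w̄)`, for `y = Re w + (Im w) J`. As the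
norm of `A` is `|p + i q|` at such a point (`norm_slicePoint`), the Cassini ball of radius `r` around
`y` is the circular set over `{z | |Δ_w(z)| < r ^ 2}` (`slicePoint_mem_cassiniBall`). In particular it
contains the whole sphere of every point in it.

Holomorphy of a stem function is tested on coordinates: a real linear functional `φ` on `A` extends to
`A ⊗ ℂ → ℂ`, and `F` is of class `C¹` with `∂F/∂z̄ = 0` exactly when all the scalar functions `φ ∘ F`
are holomorphic (`forall_differentiableOn_functional_iff`). Both directions thus become statements
about scalar functions on `{|Δ_w| < ρ}`.

* A holomorphic `g` there, with `g(z̄)` conjugate to `g(z)`, is `Σ Δ_w ^ m (a m + b m z)` with real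
  `a m`, `b m` (`exists_real_hasSum_spherePoly`). With `ζ = z - Re w` the condition `|Δ_w| < ρ` puts
  `ζ ^ 2` in a disc centred at `-(Im w) ^ 2`; the even part of `g` in `ζ` and the odd part divided by
  `ζ` are holomorphic functions of `ζ ^ 2` (`exists_differentiableOn_sq_of_even`), so they have Taylor
  series on that disc. The coordinates assemble to coefficients `a m`, `b m` in `A`, and
  `a m + z b m = (a m + y b m) + (z - y) b m` gives the spherical series (`exists_hasSum_sphStem`).

* Conversely, suppose that a spherical series converges to `f` on a Cassini ball. Averaging over
  `α + β J` and `α - β J`, where alternativity gives `J (J a) = -a`, shows that the partial sums of the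
  stem functions converge pointwise, to a function `F` expressed by the values of `f` on one slice;
  hence `f` is induced by `F` on every sphere. Convergence at one point off the real axis with `|Δ_w|`
  close to `ρ` bounds the coefficients, so the limit is holomorphic
  (`differentiableOn_of_tendsto_sphere_series`). Every point of the domain has such a
  ball, so one stem function works on all of `D`.

Since each Cassini ball is circular, spherical analyticity already forces `f` to be a slice function.
Therefore the equivalence takes the same form whether or not `D` meets the real axis.
-/

namespace SliceReg

/-! ### Scalar spherical expansions -/

/-- The characteristic polynomial `(z - w) (z - w̄)` of the sphere through `w`: the value of `Δ_y` at
complex `z` when `y = w.re + w.im J`. -/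
noncomputable def spherePoly (w z : ℂ) : ℂ := (z - w) * (z - starRingEnd ℂ w)

theorem spherePoly_eq (w z : ℂ) :
    spherePoly w z = (z - (w.re : ℂ)) ^ 2 - ((-(w.im ^ 2) : ℝ) : ℂ) := by
  apply Complex.ext <;> simp [spherePoly, pow_two] <;> ring

theorem spherePoly_conj (w z : ℂ) :
    spherePoly w (starRingEnd ℂ z) = starRingEnd ℂ (spherePoly w z) := by
  simp [spherePoly, mul_comm]

theorem spherePoly_self (w : ℂ) : spherePoly w w = 0 := by simp [spherePoly]

theorem differentiable_spherePoly (w : ℂ) : Differentiable ℂ (spherePoly w) := by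
  unfold spherePoly; fun_prop

/-- An even holomorphic function on the preimage of an open set under squaring is a holomorphic
function of the square. -/
theorem exists_differentiableOn_sq_of_even {V : Set ℂ} (hV : IsOpen V) {h : ℂ → ℂ}
    (hd : DifferentiableOn ℂ h {ζ | ζ ^ 2 ∈ V}) (heven : ∀ ζ, h (-ζ) = h ζ) :
    ∃ P : ℂ → ℂ, DifferentiableOn ℂ P V ∧ ∀ ζ, h ζ = P (ζ ^ 2) := by
  have hS : IsOpen {ζ : ℂ | ζ ^ 2 ∈ V} := hV.preimage (continuous_pow 2)
  have hr : ∀ u : ℂ, (u ^ ((2 : ℂ)⁻¹)) ^ 2 = u := fun u => by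
    simpa only [Nat.cast_ofNat] using Complex.cpow_nat_inv_pow u two_ne_zero
  have key : ∀ ζ u : ℂ, ζ ^ 2 = u → h ζ = h (u ^ ((2 : ℂ)⁻¹)) := by
    intro ζ u hu
    rcases sq_eq_sq_iff_eq_or_eq_neg.1 (hu.trans (hr u).symm) with e | e
    · rw [e]
    · rw [e, heven]
  have hne : ∀ u ∈ V, u ≠ 0 → DifferentiableAt ℂ (fun u => h (u ^ ((2 : ℂ)⁻¹))) u := by
    intro u hu h0
    -- The branch of the square root that is holomorphic near `u`.
    have heq : (fun v : ℂ => h (v ^ ((2 : ℂ)⁻¹))) =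
        fun v => h (u ^ ((2 : ℂ)⁻¹) * (v / u) ^ ((2 : ℂ)⁻¹)) := by
      funext v
      refine (key _ _ ?_).symm
      rw [mul_pow, hr, hr]; field_simp
    rw [heq]
    have h1 : DifferentiableAt ℂ (fun v : ℂ => u ^ ((2 : ℂ)⁻¹) * (v / u) ^ ((2 : ℂ)⁻¹)) u := by
      refine DifferentiableAt.const_mul ?_ _
      refine DifferentiableAt.cpow (by fun_prop) (by fun_prop) ?_
      rw [div_self h0]; exact Complex.one_mem_slitPlane
    refine DifferentiableAt.comp (g := h) u ?_ h1
    refine hd.differentiableAt (hS.mem_nhds ?_)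
    rw [Set.mem_ofPred_eq, mul_pow, hr, hr]
    rwa [mul_div_cancel₀ _ h0]
  refine ⟨fun u => h (u ^ ((2 : ℂ)⁻¹)), fun u hu => ?_, fun ζ => key ζ _ rfl⟩
  refine DifferentiableAt.differentiableWithinAt ?_
  by_cases h0 : u = 0
  · subst h0
    refine (Complex.analyticAt_of_differentiable_on_punctured_nhds_of_continuousAt ?_
      ?_).differentiableAt
    · filter_upwards [self_mem_nhdsWithin, mem_nhdsWithin_of_mem_nhds (hV.mem_nhds hu)] with v hv hv'
      exact hne v hv' hv
    · have hc : ContinuousAt (fun v : ℂ => v ^ ((2 : ℂ)⁻¹)) 0 := by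
        refine Complex.continuousAt_cpow_const_of_re_pos (Or.inl (by simp)) (by norm_num)
      refine ContinuousAt.comp (g := h) ?_ hc
      refine (hd.differentiableAt (hS.mem_nhds ?_)).continuousAt
      simpa [hr] using hu
  · exact hne u hu h0

/-- A holomorphic `g` on `|Δ| < ρ` is `Σ Δ ^ m (a m + b m z)`: the even and odd parts of `g` about
`Re w` are `P((z - Re w) ^ 2)` and `(z - Re w) Q((z - Re w) ^ 2)`, with `P` and `Q` holomorphic on
the disc of radius `ρ` around `-(Im w) ^ 2`. -/
theorem exists_hasSum_spherePoly {w : ℂ} {ρ : ℝ} {g : ℂ → ℂ}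
    (hg : DifferentiableOn ℂ g {z | ‖spherePoly w z‖ < ρ}) :
    ∃ a b : ℕ → ℂ, ∀ z, ‖spherePoly w z‖ < ρ → ∃ p q : ℂ,
      HasSum (fun m => spherePoly w z ^ m * a m) p ∧
      HasSum (fun m => spherePoly w z ^ m * b m) q ∧ g z = p + z * q := by
  set α : ℂ := (w.re : ℂ)
  set c : ℂ := ((-(w.im ^ 2) : ℝ) : ℂ)
  set S : Set ℂ := {ζ | ζ ^ 2 ∈ Metric.ball c ρ}
  have hS : IsOpen S := Metric.isOpen_ball.preimage (continuous_pow 2)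
  have hneg : ∀ ζ ∈ S, -ζ ∈ S := fun ζ hζ => by simpa [S] using hζ
  have hmem : ∀ ζ ∈ S, α + ζ ∈ {z | ‖spherePoly w z‖ < ρ} := fun ζ hζ => by
    simpa [S, spherePoly_eq, dist_eq_norm, α, c] using hζ
  have h1 : DifferentiableOn ℂ (fun ζ => g (α + ζ)) S :=
    hg.comp (by fun_prop) hmem
  have h2 : DifferentiableOn ℂ (fun ζ => g (α + -ζ)) S :=
    h1.comp (g := fun ζ => g (α + ζ)) (f := fun ζ => -ζ) (by fun_prop) hneg
  set ho : ℂ → ℂ := fun ζ => (g (α + ζ) - g (α + -ζ)) / 2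
  have hod : DifferentiableOn ℂ ho S := (h1.sub h2).div_const 2
  -- `dslope ho 0` is the even function `ζ ↦ ho ζ / ζ`, also at the removable singularity `0`.
  have hk : DifferentiableOn ℂ (dslope ho 0) S := by
    by_cases h0 : (0 : ℂ) ∈ S
    · exact (Complex.differentiableOn_dslope (hS.mem_nhds h0)).2 hod
    · exact (differentiableOn_dslope_of_notMem h0).2 hod
  have hmul : ∀ ζ, ζ * dslope ho 0 ζ = ho ζ := fun ζ => by
    have := sub_smul_dslope ho 0 ζ
    simpa [ho] using this
  obtain ⟨P, hP, hPe⟩ := exists_differentiableOn_sq_of_even Metric.isOpen_ball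
    ((h1.add h2).div_const 2) (fun ζ => by simp [add_comm])
  obtain ⟨Q, hQ, hQe⟩ := exists_differentiableOn_sq_of_even Metric.isOpen_ball hk (fun ζ => by
    by_cases h0 : ζ = 0
    · rw [h0, neg_zero]
    · apply mul_left_cancel₀ (neg_ne_zero.2 h0)
      rw [hmul, neg_mul, hmul]
      simp only [ho, neg_neg]; ring)
  set p : ℕ → ℂ := fun n => (n.factorial : ℂ)⁻¹ * iteratedDeriv n P c
  set q : ℕ → ℂ := fun n => (n.factorial : ℂ)⁻¹ * iteratedDeriv n Q c
  refine ⟨fun n => p n - α * q n, q, fun z hz => ?_⟩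
  have hu : (z - α) ^ 2 ∈ Metric.ball c ρ := by
    rwa [mem_ball_iff_norm, ← spherePoly_eq]
  have sP := Complex.hasSum_taylorSeries_on_ball hP hu
  have sQ := Complex.hasSum_taylorSeries_on_ball hQ hu
  rw [← spherePoly_eq] at sP sQ
  have sP' : HasSum (fun m => spherePoly w z ^ m * p m) (P ((z - α) ^ 2)) := by
    refine HasSum.congr_fun sP fun n => ?_
    simp only [p, smul_eq_mul]; ring
  have sQ' : HasSum (fun m => spherePoly w z ^ m * q m) (Q ((z - α) ^ 2)) := by
    refine HasSum.congr_fun sQ fun n => ?_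
    simp only [q, smul_eq_mul]; ring
  refine ⟨P ((z - α) ^ 2) - α * Q ((z - α) ^ 2), _, ?_, sQ', ?_⟩
  · refine HasSum.congr_fun (sP'.sub (sQ'.mul_left α)) fun n => ?_
    ring
  · have e1 := hPe (z - α)
    have e2 := hQe (z - α)
    have e3 := hmul (z - α)
    simp only [ho, add_sub_cancel, Pi.add_apply] at e1 e3
    rw [← e1]
    linear_combination -e3 + (z - α) * e2

/-- The coefficients of the expansion of `g` are real when `g` commutes with conjugation. -/
theorem exists_real_hasSum_spherePoly {w : ℂ} {ρ : ℝ} {g : ℂ → ℂ}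
    (hg : DifferentiableOn ℂ g {z | ‖spherePoly w z‖ < ρ})
    (hconj : ∀ z, ‖spherePoly w z‖ < ρ → g (starRingEnd ℂ z) = starRingEnd ℂ (g z)) :
    ∃ a b : ℕ → ℝ, ∀ z, ‖spherePoly w z‖ < ρ → ∃ p q : ℂ,
      HasSum (fun m => spherePoly w z ^ m * (a m : ℂ)) p ∧
      HasSum (fun m => spherePoly w z ^ m * (b m : ℂ)) q ∧ g z = p + z * q := by
  obtain ⟨a, b, hab⟩ := exists_hasSum_spherePoly hg
  have avg : ∀ (c : ℕ → ℂ) (v s t : ℂ), HasSum (fun m => v ^ m * c m) s →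
      HasSum (fun m => starRingEnd ℂ v ^ m * c m) t →
      HasSum (fun m => v ^ m * ((c m).re : ℂ)) ((s + starRingEnd ℂ t) / 2) := by
    intro c v s t hs ht
    have ht' : HasSum (fun m => v ^ m * starRingEnd ℂ (c m)) (starRingEnd ℂ t) := by
      simpa using Complex.hasSum_conj'.2 ht
    refine HasSum.congr_fun ((hs.add ht').div_const 2) fun m => ?_
    rw [Complex.re_eq_add_conj]
    ring
  refine ⟨fun m => (a m).re, fun m => (b m).re, fun z hz => ?_⟩
  have hz' : ‖spherePoly w (starRingEnd ℂ z)‖ < ρ := by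
    rwa [spherePoly_conj, Complex.norm_conj]
  obtain ⟨p, q, hp, hq, e⟩ := hab z hz
  obtain ⟨p', q', hp', hq', e'⟩ := hab _ hz'
  rw [spherePoly_conj] at hp' hq'
  refine ⟨_, _, avg a _ _ _ hp hp', avg b _ _ _ hq hq', ?_⟩
  have e2 := congrArg (starRingEnd ℂ) e'
  rw [hconj z hz] at e2
  simp only [map_add, map_mul, Complex.conj_conj] at e2
  linear_combination (e + e2) / 2

/-- If `a m * r ^ m` stays bounded, then `Σ a m u ^ m` converges to a holomorphic function on the
disc of radius `r`. -/
theorem exists_differentiableOn_hasSum_pow {a : ℕ → ℂ} {r C : ℝ} (ha : ∀ m, ‖a m‖ * r ^ m ≤ C) :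
    ∃ P : ℂ → ℂ, DifferentiableOn ℂ P (Metric.ball 0 r) ∧
      ∀ u ∈ Metric.ball (0 : ℂ) r, HasSum (fun m => u ^ m * a m) (P u) := by
  have bound : ∀ s, 0 ≤ s → s < r → ∀ m (u : ℂ), u ∈ Metric.ball (0 : ℂ) s →
      ‖u ^ m * a m‖ ≤ C * (s / r) ^ m := by
    intro s hs hsr m u hu
    have hr : 0 < r := hs.trans_lt hsr
    have hu' : ‖u‖ ≤ s := (mem_ball_zero_iff.1 hu).le
    calc ‖u ^ m * a m‖ = ‖u‖ ^ m * ‖a m‖ := by simp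
      _ ≤ s ^ m * ‖a m‖ := by gcongr
      _ = (‖a m‖ * r ^ m) * (s / r) ^ m := by rw [div_pow]; field_simp
      _ ≤ C * (s / r) ^ m := by gcongr; exact ha m
  have geo : ∀ s, 0 ≤ s → s < r → Summable fun m => C * (s / r) ^ m := fun s hs hsr =>
    (summable_geometric_of_lt_one (by have := hs.trans_lt hsr; positivity)
      ((div_lt_one (hs.trans_lt hsr)).2 hsr)).mul_left C
  have mid : ∀ u ∈ Metric.ball (0 : ℂ) r, ∃ s, 0 ≤ s ∧ s < r ∧ u ∈ Metric.ball (0 : ℂ) s := by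
    intro u hu
    obtain ⟨s, h1, h2⟩ := exists_between (mem_ball_zero_iff.1 hu)
    exact ⟨s, (norm_nonneg u).trans h1.le, h2, mem_ball_zero_iff.2 h1⟩
  refine ⟨fun u => ∑' m, u ^ m * a m, fun u hu => ?_, fun u hu => ?_⟩
  · obtain ⟨s, hs, hsr, hus⟩ := mid u hu
    exact ((Complex.differentiableOn_tsum_of_summable_norm (geo s hs hsr)
      (fun m => by fun_prop) Metric.isOpen_ball (bound s hs hsr)).differentiableAt
      (Metric.isOpen_ball.mem_nhds hus)).differentiableWithinAt
  · obtain ⟨s, hs, hsr, hus⟩ := mid u hu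
    exact (Summable.of_norm_bounded (geo s hs hsr) fun m => bound s hs hsr m u hus).hasSum

/-- A scalar spherical series with real coefficients that converges pointwise on `|Δ| < ρ` has a
holomorphic sum: convergence at a point off the real axis where `|Δ|` is close to `ρ` bounds the
coefficients. -/
theorem differentiableOn_of_tendsto_sphere_series {w : ℂ} {ρ : ℝ} {a b c : ℕ → ℝ} {T : ℂ → ℕ → ℂ}
    (hT0 : ∀ z m, T z (2 * m) = spherePoly w z ^ m * a m)
    (hT1 : ∀ z m, T z (2 * m + 1) = spherePoly w z ^ m * (z * b m - c m))
    {g : ℂ → ℂ} (hg : ∀ z, ‖spherePoly w z‖ < ρ →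
      Tendsto (fun N => ∑ n ∈ Finset.range N, T z n) atTop (𝓝 (g z))) :
    DifferentiableOn ℂ g {z | ‖spherePoly w z‖ < ρ} := by
  intro z₀ hz₀
  obtain ⟨r, hr1, hr2⟩ := exists_between (show ‖spherePoly w z₀‖ < ρ from hz₀)
  have hr : 0 < r := (norm_nonneg _).trans_lt hr1
  -- At `z₁ = Re w + i √((Im w)² + r)` the polynomial takes the real value `-r`.
  set z₁ : ℂ := ⟨w.re, √(w.im ^ 2 + r)⟩
  have him : 0 < z₁.im := Real.sqrt_pos.2 (by positivity)
  have hz₁ : spherePoly w z₁ = ((-r : ℝ) : ℂ) := by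
    have : √(w.im ^ 2 + r) * √(w.im ^ 2 + r) = w.im ^ 2 + r := Real.mul_self_sqrt (by positivity)
    apply Complex.ext
    · simp [spherePoly, z₁]; nlinarith [this]
    · simp [spherePoly, z₁]
  have hlim : Tendsto (T z₁) atTop (𝓝 0) := by
    have h := hg z₁ (by rw [hz₁, Complex.norm_real]; simpa [abs_of_pos hr] using hr2)
    have := (h.comp (tendsto_add_atTop_nat 1)).sub h
    simpa [Function.comp_def, Finset.sum_range_succ] using this
  obtain ⟨C, hC⟩ : ∃ C, ∀ n, ‖T z₁ n‖ ≤ C := by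
    obtain ⟨C, hC⟩ := (Metric.isBounded_range_of_tendsto _ hlim).exists_norm_le
    exact ⟨C, fun n => hC _ ⟨n, rfl⟩⟩
  have hpow : ∀ m (v : ℂ), ‖spherePoly w z₁ ^ m * v‖ = ‖v‖ * r ^ m := fun m v => by
    rw [hz₁, norm_mul, norm_pow, Complex.norm_real, norm_neg, Real.norm_of_nonneg hr.le, mul_comm]
  have hA : ∀ m, ‖(a m : ℂ)‖ * r ^ m ≤ C := fun m => by
    rw [← hpow, ← hT0]; exact hC _
  have hBC : ∀ m, ‖z₁ * b m - c m‖ * r ^ m ≤ C := fun m => by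
    rw [← hpow, ← hT1]; exact hC _
  have hB : ∀ m, ‖(b m : ℂ)‖ * r ^ m ≤ C / z₁.im := fun m => by
    rw [le_div_iff₀ him]
    refine le_trans ?_ (hBC m)
    have h := Complex.abs_im_le_norm (z₁ * b m - c m)
    have e : (z₁ * (b m : ℂ) - c m).im = z₁.im * b m := by simp
    rw [e, abs_mul, abs_of_pos him] at h
    rw [Complex.norm_real, Real.norm_eq_abs]
    calc |b m| * r ^ m * z₁.im = (z₁.im * |b m|) * r ^ m := by ring
      _ ≤ _ := by gcongr
  have hCc : ∀ m, ‖(c m : ℂ)‖ * r ^ m ≤ ‖z₁‖ * (C / z₁.im) + C := fun m => by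
    have h : ‖(c m : ℂ)‖ ≤ ‖z₁‖ * ‖(b m : ℂ)‖ + ‖z₁ * b m - c m‖ := by
      rw [← norm_mul]
      calc ‖(c m : ℂ)‖ = ‖z₁ * b m - (z₁ * b m - c m)‖ := by congr 1; ring
        _ ≤ _ := norm_sub_le _ _
    calc ‖(c m : ℂ)‖ * r ^ m ≤ (‖z₁‖ * ‖(b m : ℂ)‖ + ‖z₁ * b m - c m‖) * r ^ m := by gcongr
      _ = ‖z₁‖ * (‖(b m : ℂ)‖ * r ^ m) + ‖z₁ * b m - c m‖ * r ^ m := by ring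
      _ ≤ _ := by gcongr; exacts [hB m, hBC m]
  obtain ⟨PA, dA, sA⟩ := exists_differentiableOn_hasSum_pow hA
  obtain ⟨PB, dB, sB⟩ := exists_differentiableOn_hasSum_pow hB
  obtain ⟨PC, dC, sC⟩ := exists_differentiableOn_hasSum_pow hCc
  have hball : ∀ z, ‖spherePoly w z‖ < r → spherePoly w z ∈ Metric.ball (0 : ℂ) r := fun z hz =>
    mem_ball_zero_iff.2 hz
  have heq : ∀ z, ‖spherePoly w z‖ < r →
      g z = PA (spherePoly w z) + (z * PB (spherePoly w z) - PC (spherePoly w z)) := by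
    intro z hz
    refine tendsto_nhds_unique (hg z (hz.trans hr2)) (HasSum.tendsto_sum_nat ?_)
    refine HasSum.even_add_odd ?_ ?_
    · simp only [hT0]; exact sA _ (hball z hz)
    · simp only [hT1]
      refine HasSum.congr_fun (((sB _ (hball z hz)).mul_left z).sub (sC _ (hball z hz))) fun m => ?_
      ring
  have hopen : IsOpen {z | ‖spherePoly w z‖ < r} :=
    isOpen_lt (differentiable_spherePoly w).continuous.norm continuous_const
  have hcomp : ∀ {P : ℂ → ℂ}, DifferentiableOn ℂ P (Metric.ball 0 r) →
      DifferentiableAt ℂ (fun z => P (spherePoly w z)) z₀ := fun hP =>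
    (hP.differentiableAt (Metric.isOpen_ball.mem_nhds (hball z₀ hr1))).comp z₀
      (differentiable_spherePoly w z₀)
  refine DifferentiableAt.differentiableWithinAt ?_
  refine ((hcomp dA).add ((differentiableAt_id.mul (hcomp dB)).sub
    (hcomp dC))).congr_of_eventuallyEq ?_
  filter_upwards [hopen.mem_nhds hr1] with z hz
  exact heq z hz

/-! ### Points of the quadratic cone -/

section Points

variable {A : Type*} [NormedNonAssocRing A] [NormedSpace ℝ A]

/-- The point `α + β J` of `A` corresponding to `z = α + i β`. -/
def slicePoint (z : ℂ) (J : A) : A := z.re • (1 : A) + z.im • J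

theorem slicePoint_ofReal (r : ℝ) (J : A) : slicePoint (r : ℂ) J = r • (1 : A) := by
  simp [slicePoint]

theorem slicePoint_add (z w : ℂ) (J : A) :
    slicePoint (z + w) J = slicePoint z J + slicePoint w J := by
  simp only [slicePoint, Complex.add_re, Complex.add_im, add_smul]; abel

theorem slicePoint_sub (z w : ℂ) (J : A) :
    slicePoint (z - w) J = slicePoint z J - slicePoint w J := by
  simp only [slicePoint, Complex.sub_re, Complex.sub_im, sub_smul]; abel

theorem slicePoint_conj (z : ℂ) (J : A) :
    slicePoint (starRingEnd ℂ z) J = slicePoint z (-J) := by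
  simp [slicePoint]

variable [IsScalarTower ℝ A A] [SMulCommClass ℝ A A]

theorem slicePoint_mul {J : A} (hJ : J * J = -1) (z w : ℂ) :
    slicePoint (z * w) J = slicePoint z J * slicePoint w J := by
  simp only [slicePoint, Complex.mul_re, Complex.mul_im, add_mul, mul_add, smul_mul_smul_comm, hJ,
    one_mul, mul_one, sub_smul, add_smul, smul_neg]
  abel

variable [StarRing A]

theorem neg_mem_imagUnits [Nontrivial A] {J : A} (hJ : J ∈ imagUnits A) : -J ∈ imagUnits A := by
  have hs := star_imagUnit hJ
  refine ⟨Or.inr ⟨0, 1, ?_, ?_, by norm_num⟩, by rw [neg_mul_neg, hJ.2]⟩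
  · rw [star_neg, hs]; simp
  · rw [star_neg, hs, neg_neg, neg_mul, hJ.2]; simp

variable [StarModule ℝ A]

/-- Every point of the quadratic cone lies in a slice `ℝ + ℝ J`. -/
theorem exists_eq_slicePoint (hne : (imagUnits A).Nonempty) {x : A} (hx : x ∈ quadraticCone A) :
    ∃ (z : ℂ) (J : A), J ∈ imagUnits A ∧ x = slicePoint z J := by
  rcases hx with ⟨r, rfl⟩ | ⟨t, n, ht, hn, htn⟩
  · obtain ⟨J, hJ⟩ := hne
    exact ⟨r, J, hJ, (slicePoint_ofReal r J).symm⟩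
  have hs : star x = t • (1 : A) - x := by rw [← ht]; abel
  have hxx : x * x = t • x - n • (1 : A) := by
    rw [hs, mul_sub, mul_smul_comm, mul_one] at hn
    rw [← hn]; abel
  set d : ℝ := √(n - t ^ 2 / 4)
  have hd : 0 < d := Real.sqrt_pos.2 (by linarith)
  have hdd : d * d = n - t ^ 2 / 4 := Real.mul_self_sqrt (by linarith)
  set J : A := d⁻¹ • (x - (t / 2) • (1 : A)) with hJdef
  have hstar : star J = -J := by
    rw [hJdef]
    simp only [star_smul, star_sub, star_one, star_trivial, hs, ← smul_neg]
    congr 1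
    have : t • (1 : A) = (t / 2) • (1 : A) + (t / 2) • (1 : A) := by rw [← add_smul]; ring_nf
    rw [this]; abel
  have hJ2 : J * J = -1 := by
    have h1 : (x - (t / 2) • (1 : A)) * (x - (t / 2) • (1 : A)) = (-(d * d)) • (1 : A) := by
      simp only [sub_mul, mul_sub, smul_mul_assoc, mul_smul_comm, one_mul, mul_one, hxx, hdd]
      module
    rw [hJdef, smul_mul_smul_comm, h1, smul_smul]
    have : d⁻¹ * d⁻¹ * -(d * d) = -1 := by field_simp
    rw [this, neg_smul, one_smul]
  refine ⟨⟨t / 2, d⟩, J, ⟨Or.inr ⟨0, 1, ?_, ?_, by norm_num⟩, hJ2⟩, ?_⟩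
  · rw [hstar]; simp
  · rw [hstar, mul_neg, hJ2]; simp
  · simp only [slicePoint, hJdef, smul_smul, mul_inv_cancel₀ hd.ne', one_smul]; abel

variable [Nontrivial A]

theorem star_slicePoint {J : A} (hJ : J ∈ imagUnits A) (z : ℂ) :
    star (slicePoint z J) = slicePoint (starRingEnd ℂ z) J := by
  rw [slicePoint_conj]; simp [slicePoint, star_imagUnit hJ]

theorem slicePoint_add_star {J : A} (hJ : J ∈ imagUnits A) (z : ℂ) :
    slicePoint z J + star (slicePoint z J) = (2 * z.re) • (1 : A) := by
  rw [star_slicePoint hJ, ← slicePoint_add, Complex.add_conj, slicePoint_ofReal]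

theorem slicePoint_mul_star {J : A} (hJ : J ∈ imagUnits A) (z : ℂ) :
    slicePoint z J * star (slicePoint z J) = Complex.normSq z • (1 : A) := by
  rw [star_slicePoint hJ, ← slicePoint_mul hJ.2, Complex.mul_conj, slicePoint_ofReal]

theorem slicePoint_mem_quadraticCone {J : A} (hJ : J ∈ imagUnits A) (z : ℂ) :
    slicePoint z J ∈ quadraticCone A := by
  by_cases h : z.im = 0
  · exact Or.inl ⟨z.re, by simp [slicePoint, h]⟩
  · refine Or.inr ⟨_, _, slicePoint_add_star hJ z, slicePoint_mul_star hJ z, ?_⟩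
    have : 0 < z.im ^ 2 := by positivity
    rw [Complex.normSq_apply]; nlinarith

theorem norm_slicePoint (hnorm : NormOnCone A) {J : A} (hJ : J ∈ imagUnits A) (z : ℂ) :
    ‖slicePoint z J‖ = ‖z‖ := by
  rw [hnorm _ (slicePoint_mem_quadraticCone hJ z) _ (slicePoint_mul_star hJ z),
    Complex.normSq_eq_norm_sq, Real.sqrt_sq (norm_nonneg z)]

theorem slicePoint_mem_circ {D : Set ℂ} {J : A} (hJ : J ∈ imagUnits A) {z : ℂ} (hz : z ∈ D) :
    slicePoint z J ∈ circ A D :=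
  ⟨slicePoint_mem_quadraticCone hJ z, z, J, hz, hJ, rfl⟩

theorem sq_sub_mul_add_normSq_eq_spherePoly (w z : ℂ) :
    z * z - z * ((2 * w.re : ℝ) : ℂ) + (Complex.normSq w : ℝ) = spherePoly w z := by
  rw [← Complex.mul_conj, ← Complex.add_conj, spherePoly]; ring

theorem cassini_slicePoint (hnorm : NormOnCone A) {I J : A} (hI : I ∈ imagUnits A)
    (hJ : J ∈ imagUnits A) (w z : ℂ) :
    cassini (slicePoint z I) (slicePoint w J) = √‖spherePoly w z‖ := by
  rw [cassini, slicePoint_add_star hJ, slicePoint_mul_star hJ, ← slicePoint_ofReal _ I,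
    ← slicePoint_ofReal (Complex.normSq w) I, ← slicePoint_mul hI.2, ← slicePoint_mul hI.2,
    ← slicePoint_sub, ← slicePoint_add, sq_sub_mul_add_normSq_eq_spherePoly, norm_slicePoint hnorm hI]

theorem slicePoint_mem_cassiniBall (hnorm : NormOnCone A) {I J : A} (hI : I ∈ imagUnits A)
    (hJ : J ∈ imagUnits A) {w z : ℂ} {r : ℝ} (hr : 0 < r) :
    slicePoint z I ∈ cassiniBall (slicePoint w J) r ↔ ‖spherePoly w z‖ < r ^ 2 := by
  simp only [cassiniBall, Set.mem_ofPred_eq, slicePoint_mem_quadraticCone hI, true_and,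
    cassini_slicePoint hnorm hI hJ, Real.sqrt_lt' hr]

end Points

/-! ### Stem functions of spherical polynomials -/

namespace Complexification

section Ring

variable {A : Type*} [NonAssocRing A]

@[simp] theorem mul_re (v w : Complexification A) : (v * w).re = v.re * w.re - v.im * w.im := rfl

@[simp] theorem mul_im (v w : Complexification A) : (v * w).im = v.re * w.im + v.im * w.re := rfl

@[simp] theorem sub_re (v w : Complexification A) : (v - w).re = v.re - w.re := rfl

@[simp] theorem sub_im (v w : Complexification A) : (v - w).im = v.im - w.im := rfl

@[simp] theorem ofAlg_re (a : A) : (ofAlg a).re = a := rfl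

@[simp] theorem ofAlg_im (a : A) : (ofAlg a).im = 0 := rfl

@[simp] theorem conj_re (v : Complexification A) : v.conj.re = v.re := rfl

@[simp] theorem conj_im (v : Complexification A) : v.conj.im = -v.im := rfl

@[simp] theorem ofComplex_re [Module ℝ A] (z : ℂ) :
    (ofComplex z : Complexification A).re = z.re • 1 := rfl

@[simp] theorem ofComplex_im [Module ℝ A] (z : ℂ) :
    (ofComplex z : Complexification A).im = z.im • 1 := rfl

theorem conj_mul (v w : Complexification A) : (v * w).conj = v.conj * w.conj := by
  ext <;> simp [add_comm]

theorem conj_ofAlg (a : A) : (ofAlg a).conj = ofAlg a := by ext <;> simp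

theorem conj_ofComplex [Module ℝ A] (z : ℂ) :
    (ofComplex z : Complexification A).conj = ofComplex (starRingEnd ℂ z) := by
  ext <;> simp

end Ring

variable {A : Type*} [NonAssocRing A] [Module ℝ A]

/-- The extension to `A ⊗ ℂ` of a real linear functional on `A`. -/
noncomputable def functional (φ : A →ₗ[ℝ] ℝ) (v : Complexification A) : ℂ :=
  φ v.re + φ v.im * Complex.I

@[simp] theorem functional_re (φ : A →ₗ[ℝ] ℝ) (v : Complexification A) :
    (functional φ v).re = φ v.re := by simp [functional]

@[simp] theorem functional_im (φ : A →ₗ[ℝ] ℝ) (v : Complexification A) :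
    (functional φ v).im = φ v.im := by simp [functional]

theorem functional_conj (φ : A →ₗ[ℝ] ℝ) (v : Complexification A) :
    functional φ v.conj = starRingEnd ℂ (functional φ v) := by
  apply Complex.ext <;> simp

theorem functional_ofAlg (φ : A →ₗ[ℝ] ℝ) (a : A) : functional φ (ofAlg a) = φ a := by
  simp [functional]

variable [IsScalarTower ℝ A A]

theorem functional_ofComplex_mul (φ : A →ₗ[ℝ] ℝ) (z : ℂ) (v : Complexification A) :
    functional φ (ofComplex z * v) = z * functional φ v := by
  apply Complex.ext <;> simp

theorem ofComplex_mul_mul (z : ℂ) (v w : Complexification A) :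
    ofComplex z * v * w = ofComplex z * (v * w) := by
  ext <;> simp [sub_mul, add_mul, smul_add, smul_sub, smul_mul_assoc] <;> abel

theorem ofComplex_mul (z w : ℂ) :
    (ofComplex (z * w) : Complexification A) = ofComplex z * ofComplex w := by
  ext <;> simp [smul_smul, sub_smul, add_smul]

theorem ofComplex_pow (z : ℂ) (m : ℕ) :
    (ofComplex z : Complexification A).pow m = ofComplex (z ^ m) := by
  induction m with
  | zero => ext <;> simp [pow] <;> rfl
  | succ m ih => rw [pow, ih, pow_succ, ofComplex_mul]

end Complexification

open Complexification

section SphericalStem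

variable {A : Type*} [NormedNonAssocRing A] [NormedSpace ℝ A] [IsScalarTower ℝ A A]
  [SMulCommClass ℝ A A] [StarRing A] [StarModule ℝ A] [Nontrivial A]

theorem charStem_slicePoint {J : A} (hJ : J ∈ imagUnits A) (w z : ℂ) :
    charStem (slicePoint w J) z = ofComplex (spherePoly w z) := by
  have h1 := slicePoint_add_star hJ w
  have h2 := slicePoint_mul_star hJ w
  set y := slicePoint w J
  have h3 : z.re • y + z.re • star y = (z.re * (2 * w.re)) • (1 : A) := by
    rw [← smul_add, h1, smul_smul]
  have h4 : z.im • y + z.im • star y = (z.im * (2 * w.re)) • (1 : A) := by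
    rw [← smul_add, h1, smul_smul]
  rw [← sq_sub_mul_add_normSq_eq_spherePoly]
  ext
  · simp only [charStem, linStem, mul_re, sub_re, sub_im, ofComplex_re, ofComplex_im, ofAlg_re,
      ofAlg_im, sub_zero, sub_mul, mul_sub, smul_mul_assoc, mul_smul_comm, one_mul, mul_one, h2,
      Complex.sub_re, Complex.add_re, Complex.mul_re, Complex.ofReal_re, Complex.ofReal_im,
      mul_zero, add_smul, sub_smul, ← h3, smul_smul]
    module
  · simp only [charStem, linStem, mul_im, sub_re, sub_im, ofComplex_re, ofComplex_im, ofAlg_re,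
      ofAlg_im, sub_zero, mul_sub, smul_mul_assoc, mul_smul_comm, one_mul, mul_one,
      Complex.sub_im, Complex.add_im, Complex.mul_im, Complex.ofReal_re, Complex.ofReal_im,
      mul_zero, zero_add, add_zero, add_smul, sub_smul, ← h4, smul_smul]
    module

theorem sphStem_two_mul {J : A} (hJ : J ∈ imagUnits A) (w z : ℂ) (m : ℕ) :
    sphStem (slicePoint w J) (2 * m) z = ofComplex (spherePoly w z ^ m) := by
  rw [sphStem, if_pos (even_two_mul m), charStem_slicePoint hJ, ofComplex_pow]
  congr 2; omega

theorem sphStem_two_mul_add_one {J : A} (hJ : J ∈ imagUnits A) (w z : ℂ) (m : ℕ) :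
    sphStem (slicePoint w J) (2 * m + 1) z =
      ofComplex (spherePoly w z ^ m) * linStem (slicePoint w J) z := by
  rw [sphStem, if_neg (by simp), charStem_slicePoint hJ, ofComplex_pow]
  congr 3; omega

/-- The spherical monomial `S_{y,n}` times a constant is a stem function on all of `ℂ`. -/
theorem isStem_sphStem_mul {J : A} (hJ : J ∈ imagUnits A) (w : ℂ) (n : ℕ) (s : A) :
    IsStem Set.univ fun z => sphStem (slicePoint w J) n z * ofAlg s := by
  intro z _
  simp only [Complexification.conj_mul, conj_ofAlg]
  congr 1
  rcases Nat.even_or_odd' n with ⟨m, rfl | rfl⟩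
  · rw [sphStem_two_mul hJ, sphStem_two_mul hJ, conj_ofComplex, spherePoly_conj, map_pow]
  · rw [sphStem_two_mul_add_one hJ, sphStem_two_mul_add_one hJ, Complexification.conj_mul,
      conj_ofComplex, spherePoly_conj, map_pow]
    congr 1
    ext <;> simp [linStem]

theorem sphTerm_slicePoint {I J : A} (hI : I ∈ imagUnits A) (hJ : J ∈ imagUnits A) (w z : ℂ)
    (n : ℕ) (s : A) :
    sphTerm (slicePoint w J) n s (slicePoint z I) =
      (sphStem (slicePoint w J) n z * ofAlg s).re +
        I * (sphStem (slicePoint w J) n z * ofAlg s).im :=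
  sliceFun_apply (isStem_sphStem_mul hJ w n s) (Set.mem_univ z) hI

theorem functional_sphStem_two_mul (φ : A →ₗ[ℝ] ℝ) {J : A} (hJ : J ∈ imagUnits A) (w z : ℂ)
    (m : ℕ) (s : A) :
    functional φ (sphStem (slicePoint w J) (2 * m) z * ofAlg s) = spherePoly w z ^ m * φ s := by
  rw [sphStem_two_mul hJ, functional_ofComplex_mul, functional_ofAlg]

theorem functional_sphStem_two_mul_add_one (φ : A →ₗ[ℝ] ℝ) {J : A} (hJ : J ∈ imagUnits A)
    (w z : ℂ) (m : ℕ) (s : A) :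
    functional φ (sphStem (slicePoint w J) (2 * m + 1) z * ofAlg s) =
      spherePoly w z ^ m * (z * φ s - φ (slicePoint w J * s)) := by
  rw [sphStem_two_mul_add_one hJ, ofComplex_mul_mul, functional_ofComplex_mul]
  congr 1
  apply Complex.ext <;> simp [linStem, sub_mul]

end SphericalStem

/-! ### Holomorphic stem functions -/

section Holomorphic

variable {A : Type*} [NormedNonAssocRing A] [NormedSpace ℝ A] [FiniteDimensional ℝ A]

theorem eq_zero_of_forall_linear {a : A} (h : ∀ φ : A →ₗ[ℝ] ℝ, φ a = 0) : a = 0 :=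
  (Module.finBasis ℝ A).ext_elem fun i => by simpa using h ((Module.finBasis ℝ A).coord i)

theorem hasSum_of_forall_linear {v : ℕ → A} {a : A}
    (h : ∀ φ : A →ₗ[ℝ] ℝ, HasSum (fun n => φ (v n)) (φ a)) : HasSum v a := by
  have hs := hasSum_sum fun i (_ : i ∈ Finset.univ) =>
    (h ((Module.finBasis ℝ A).coord i)).smul_const ((Module.finBasis ℝ A) i)
  simpa only [Module.Basis.coord_apply, Module.Basis.sum_repr] using hs

theorem hasFDerivAt_functional (φ : A →ₗ[ℝ] ℝ) {F : ℂ → Complexification A} {z : ℂ}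
    (h1 : DifferentiableAt ℝ (fun ζ => (F ζ).re) z)
    (h2 : DifferentiableAt ℝ (fun ζ => (F ζ).im) z) :
    HasFDerivAt (fun ζ => functional φ (F ζ))
      (Complex.ofRealCLM.comp (φ.toContinuousLinearMap.comp (fderiv ℝ (fun ζ => (F ζ).re) z)) +
        (Complex.ofRealCLM.comp (φ.toContinuousLinearMap.comp
          (fderiv ℝ (fun ζ => (F ζ).im) z))).smulRight Complex.I) z := by
  have e1 := Complex.ofRealCLM.hasFDerivAt.comp z
    (φ.toContinuousLinearMap.hasFDerivAt.comp z h1.hasFDerivAt)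
  have e2 := Complex.ofRealCLM.hasFDerivAt.comp z
    (φ.toContinuousLinearMap.hasFDerivAt.comp z h2.hasFDerivAt)
  exact e1.add (e2.mul_const' Complex.I)

/-- The equation `∂F/∂z̄ = 0` is the Cauchy–Riemann equation for all coordinates of `F`. -/
theorem forall_differentiableAt_functional_iff {F : ℂ → Complexification A} {z : ℂ}
    (h1 : DifferentiableAt ℝ (fun ζ => (F ζ).re) z)
    (h2 : DifferentiableAt ℝ (fun ζ => (F ζ).im) z) :
    (∀ φ : A →ₗ[ℝ] ℝ, DifferentiableAt ℂ (fun ζ => functional φ (F ζ)) z) ↔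
      (dbar F z).re = 0 ∧ (dbar F z).im = 0 := by
  set L1 := fderiv ℝ (fun ζ => (F ζ).re) z with hL1
  set L2 := fderiv ℝ (fun ζ => (F ζ).im) z with hL2
  have key : ∀ φ : A →ₗ[ℝ] ℝ, DifferentiableAt ℂ (fun ζ => functional φ (F ζ)) z ↔
      φ (L1 Complex.I) = -φ (L2 1) ∧ φ (L2 Complex.I) = φ (L1 1) := by
    intro φ
    have hd := hasFDerivAt_functional φ h1 h2
    rw [differentiableAt_complex_iff_differentiableAt_real, hd.fderiv]
    simp only [hd.differentiableAt, true_and, Complex.ext_iff]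
    simp [← hL1, ← hL2]
  simp only [key, dbar, ← hL1, ← hL2, smul_eq_zero]
  norm_num
  constructor
  · intro h
    constructor <;> refine eq_zero_of_forall_linear fun φ => ?_
    · rw [map_sub, (h φ).2, sub_self]
    · rw [map_add, (h φ).1]; ring
  · rintro ⟨e1, e2⟩ φ
    have e1 := congrArg φ e1
    have e2 := congrArg φ e2
    simp only [map_sub, map_add, map_zero] at e1 e2
    constructor <;> linarith

theorem contDiffOn_of_forall_linear {D : Set ℂ} {f : ℂ → A}
    (h : ∀ φ : A →ₗ[ℝ] ℝ, ContDiffOn ℝ 1 (fun z => φ (f z)) D) : ContDiffOn ℝ 1 f D := by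
  have hs : ContDiffOn ℝ 1 (fun z => ∑ i, (Module.finBasis ℝ A).coord i (f z) •
      (Module.finBasis ℝ A) i) D :=
    ContDiffOn.sum fun i _ => (h _).smul contDiffOn_const
  simpa only [Module.Basis.coord_apply, Module.Basis.sum_repr] using hs

/-- A stem function is of class `C¹` with `∂F/∂z̄ = 0` on an open set exactly when all its
coordinates are holomorphic there. -/
theorem forall_differentiableOn_functional_iff {D : Set ℂ} (hD : IsOpen D)
    {F : ℂ → Complexification A} :
    (∀ φ : A →ₗ[ℝ] ℝ, DifferentiableOn ℂ (fun ζ => functional φ (F ζ)) D) ↔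
      ContDiffOn ℝ 1 (fun z => (F z).re) D ∧ ContDiffOn ℝ 1 (fun z => (F z).im) D ∧
        ∀ z ∈ D, (dbar F z).re = 0 ∧ (dbar F z).im = 0 := by
  have hdiff : ∀ {f : ℂ → A}, ContDiffOn ℝ 1 f D → ∀ z ∈ D, DifferentiableAt ℝ f z :=
    fun h z hz => (h.differentiableOn one_ne_zero).differentiableAt (hD.mem_nhds hz)
  constructor
  · intro h
    have hc : ∀ φ : A →ₗ[ℝ] ℝ, ContDiffOn ℝ 1 (fun ζ => functional φ (F ζ)) D := fun φ =>
      ((h φ).contDiffOn hD).restrict_scalars ℝ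
    have h1 : ContDiffOn ℝ 1 (fun z => (F z).re) D := contDiffOn_of_forall_linear fun φ => by
      simpa [Function.comp_def] using Complex.reCLM.contDiff.comp_contDiffOn (hc φ)
    have h2 : ContDiffOn ℝ 1 (fun z => (F z).im) D := contDiffOn_of_forall_linear fun φ => by
      simpa [Function.comp_def] using Complex.imCLM.contDiff.comp_contDiffOn (hc φ)
    exact ⟨h1, h2, fun z hz => (forall_differentiableAt_functional_iff (hdiff h1 z hz)
      (hdiff h2 z hz)).1 fun φ => (h φ).differentiableAt (hD.mem_nhds hz)⟩
  · rintro ⟨h1, h2, h3⟩ φ z hz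
    exact ((forall_differentiableAt_functional_iff (hdiff h1 z hz) (hdiff h2 z hz)).2
      (h3 z hz) φ).differentiableWithinAt

end Holomorphic

/-! ### Slice regularity is spherical analyticity -/

section Equivalence

variable {A : Type*} [NormedNonAssocRing A] [NormedSpace ℝ A] [IsScalarTower ℝ A A]
  [SMulCommClass ℝ A A] [StarRing A] [StarModule ℝ A] [FiniteDimensional ℝ A] [Nontrivial A]

/-- Spherical expansion of a stem function with holomorphic coordinates. -/
theorem exists_hasSum_sphStem {J : A} (hJ : J ∈ imagUnits A) {w : ℂ} {ρ : ℝ}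
    {F : ℂ → Complexification A}
    (hF : ∀ φ : A →ₗ[ℝ] ℝ,
      DifferentiableOn ℂ (fun z => functional φ (F z)) {z | ‖spherePoly w z‖ < ρ})
    (hstem : IsStem {z | ‖spherePoly w z‖ < ρ} F) :
    ∃ s : ℕ → A, ∀ z, ‖spherePoly w z‖ < ρ →
      HasSum (fun n => (sphStem (slicePoint w J) n z * ofAlg (s n)).re) (F z).re ∧
      HasSum (fun n => (sphStem (slicePoint w J) n z * ofAlg (s n)).im) (F z).im := by
  set e := Module.finBasis ℝ A
  choose a b hab using fun i => exists_real_hasSum_spherePoly (hF (e.coord i))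
    fun z hz => by rw [hstem z hz, functional_conj]
  set α : ℕ → A := fun m => ∑ i, a i m • e i
  set β : ℕ → A := fun m => ∑ i, b i m • e i
  -- `Δ ^ m (α m + z β m) = Δ ^ m (α m + y β m) + Δ ^ m (z - y) β m`
  set s : ℕ → A := fun n =>
    if Even n then α (n / 2) + slicePoint w J * β (n / 2) else β (n / 2)
  have hs0 : ∀ m, s (2 * m) = α m + slicePoint w J * β m := fun m => by simp [s]
  have hs1 : ∀ m, s (2 * m + 1) = β m := fun m => by
    simp only [s, Nat.not_even_two_mul_add_one, if_false]
    congr 1; omega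
  refine ⟨s, fun z hz => ?_⟩
  choose p q hp hq hpq using fun i => hab i z hz
  have comb : ∀ (ψ : A →ₗ[ℝ] ℝ) {c : Fin (Module.finrank ℝ A) → ℕ → ℝ}
      {v : Fin (Module.finrank ℝ A) → ℂ},
      (∀ i, HasSum (fun m => spherePoly w z ^ m * (c i m : ℂ)) (v i)) →
      HasSum (fun m => spherePoly w z ^ m * (ψ (∑ i, c i m • e i) : ℂ)) (∑ i, v i * ψ (e i)) := by
    intro ψ c v h
    refine HasSum.congr_fun (hasSum_sum fun i (_ : i ∈ Finset.univ) =>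
      (h i).mul_right (ψ (e i) : ℂ)) fun m => ?_
    simp only [map_sum, map_smul, smul_eq_mul, Complex.ofReal_sum, Complex.ofReal_mul,
      Finset.mul_sum, mul_assoc]
  have main : ∀ φ : A →ₗ[ℝ] ℝ, HasSum
      (fun n => functional φ (sphStem (slicePoint w J) n z * ofAlg (s n))) (functional φ (F z)) := by
    intro φ
    have hα := comb φ hp
    have hβ := comb φ hq
    have hy := comb (φ ∘ₗ LinearMap.mulLeft ℝ (slicePoint w J)) hq
    have hFz : functional φ (F z) = ∑ i, p i * φ (e i) + z * ∑ i, q i * φ (e i) := by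
      have hφ : ∀ x : A, φ x = ∑ i, e.coord i x * φ (e i) := fun x => by
        conv_lhs => rw [← e.sum_repr x, map_sum]
        simp only [map_smul, smul_eq_mul, Module.Basis.coord_apply]
      have : functional φ (F z) = ∑ i, functional (e.coord i) (F z) * φ (e i) := by
        apply Complex.ext
        · simp [hφ (F z).re]
        · simp [hφ (F z).im]
      rw [this, Finset.mul_sum, ← Finset.sum_add_distrib]
      refine Finset.sum_congr rfl fun i _ => ?_
      rw [hpq i]; ring
    have h0 := hα.add hy
    have h1 := (hβ.mul_left z).sub hy
    have h01 := HasSum.even_add_odd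
      (f := fun n => functional φ (sphStem (slicePoint w J) n z * ofAlg (s n)))
      (h0.congr_fun fun m => ?_) (h1.congr_fun fun m => ?_)
    · convert h01 using 1
      rw [hFz]; ring
    · rw [functional_sphStem_two_mul φ hJ, hs0, map_add, Complex.ofReal_add, mul_add]
      rfl
    · rw [functional_sphStem_two_mul_add_one φ hJ, hs1, mul_sub, mul_left_comm]
      rfl
  constructor <;> refine hasSum_of_forall_linear fun φ => ?_
  · simpa using Complex.hasSum_re (main φ)
  · simpa using Complex.hasSum_im (main φ)

theorem IsSliceRegular.isSphericallyAnalytic (hnorm : NormOnCone A) {D : Set ℂ} (hD : IsOpen D)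
    (hDconj : ∀ z ∈ D, starRingEnd ℂ z ∈ D) {f : circ A D → A} (hf : IsSliceRegular D f) :
    IsSphericallyAnalytic D f := by
  obtain ⟨F, hstem, h1, h2, h3, hfF⟩ := hf
  have hF := (forall_differentiableOn_functional_iff hD).2 ⟨h1, h2, h3⟩
  rintro ⟨_, -, w, J, hw, hJ, rfl⟩
  change ∃ r : ℝ, 0 < r ∧ cassiniBall (slicePoint w J) r ⊆ circ A D ∧ _
  obtain ⟨r, hr, hball⟩ := Metric.isOpen_iff.1 hD w hw
  -- `|z - w| |z - w̄| < r ^ 2` forces `z` to be within `r` of `w` or of `w̄`.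
  have hsub : ∀ z, ‖spherePoly w z‖ < r ^ 2 → z ∈ D := by
    intro z hz
    by_contra hzD
    have e1 : r ≤ ‖z - w‖ := by
      by_contra! h
      exact hzD (hball (mem_ball_iff_norm.2 h))
    have e2 : r ≤ ‖z - starRingEnd ℂ w‖ := by
      by_contra! h
      have hz' : starRingEnd ℂ z ∈ D := hball (mem_ball_iff_norm.2 (by
        rwa [← Complex.norm_conj, map_sub, Complex.conj_conj]))
      exact hzD (by simpa using hDconj _ hz')
    rw [spherePoly, norm_mul] at hz
    nlinarith
  refine ⟨r, hr, ?_, ?_⟩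
  · intro x hx
    obtain ⟨z, I, hI, rfl⟩ := exists_eq_slicePoint ⟨J, hJ⟩ hx.1
    exact slicePoint_mem_circ hI (hsub z ((slicePoint_mem_cassiniBall hnorm hI hJ hr).1 hx))
  obtain ⟨s, hs⟩ := exists_hasSum_sphStem hJ (fun φ => (hF φ).mono hsub)
    fun z hz => hstem z (hsub z hz)
  refine ⟨s, ?_⟩
  rintro ⟨_, _, z, I, hz, hI, rfl⟩ hx
  change slicePoint z I ∈ cassiniBall (slicePoint w J) r at hx
  rw [hfF]
  change Tendsto (fun N => ∑ n ∈ Finset.range N, sphTerm (slicePoint w J) n (s n) (slicePoint z I))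
    atTop (𝓝 (sliceFun F (slicePoint z I)))
  rw [show sliceFun F (slicePoint z I) = _ from sliceFun_apply hstem hz hI]
  obtain ⟨hre, him⟩ := hs z ((slicePoint_mem_cassiniBall hnorm hI hJ hr).1 hx)
  simp only [sphTerm_slicePoint hI hJ]
  exact (hre.add ((LinearMap.mulLeft ℝ I).toContinuousLinearMap.hasSum him)).tendsto_sum_nat

theorem IsSphericallyAnalytic.isSliceRegular (halt : IsAlternative A) (hnorm : NormOnCone A)
    {D : Set ℂ} (hD : IsOpen D) (hne : (imagUnits A).Nonempty) {f : circ A D → A}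
    (hf : IsSphericallyAnalytic D f) : IsSliceRegular D f := by
  classical
  obtain ⟨J, hJ⟩ := hne
  have hneg : ∀ {I : A}, I ∈ imagUnits A → ∀ a, I * (I * a) = -a := fun hI a => by
    rw [← (halt _ a).1, hI.2, neg_one_mul]
  set g : A → A := fun x => if h : x ∈ circ A D then f ⟨x, h⟩ else 0
  have hg : ∀ x : circ A D, g x = f x := fun x => by simp [g]
  -- The stem function is determined by the values on the slice of `J`.
  set F : ℂ → Complexification A := fun z =>
    ⟨(1 / 2 : ℝ) • (g (slicePoint z J) + g (slicePoint z (-J))),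
      -((1 / 2 : ℝ) • (J * (g (slicePoint z J) - g (slicePoint z (-J)))))⟩
  have hstem : IsStem D F := by
    intro z _
    simp only [F, slicePoint_conj, neg_neg]
    ext
    · simp [add_comm]
    · simp [← smul_neg, ← mul_neg]
  have loc : ∀ w ∈ D, ∃ ρ : ℝ, 0 < ρ ∧
      (∀ I ∈ imagUnits A, ∀ z, ‖spherePoly w z‖ < ρ →
        g (slicePoint z I) = (F z).re + I * (F z).im) ∧
      ∀ φ : A →ₗ[ℝ] ℝ,
        DifferentiableOn ℂ (fun z => functional φ (F z)) {z | ‖spherePoly w z‖ < ρ} := by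
    intro w hw
    obtain ⟨r, hr, hsub, s, hs⟩ := hf ⟨_, slicePoint_mem_circ hJ hw⟩
    set S : ℂ → ℕ → Complexification A := fun z n => sphStem (slicePoint w J) n z * ofAlg (s n)
    have lim : ∀ I ∈ imagUnits A, ∀ z, ‖spherePoly w z‖ < r ^ 2 → Tendsto
        (fun N => ∑ n ∈ Finset.range N, (S z n).re + I * ∑ n ∈ Finset.range N, (S z n).im)
        atTop (𝓝 (g (slicePoint z I))) := by
      intro I hI z hz
      have hx := (slicePoint_mem_cassiniBall hnorm hI hJ hr).2 hz
      have h := hs ⟨_, hsub hx⟩ hx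
      rw [← hg] at h
      simpa only [sphTerm_slicePoint hI hJ, Finset.sum_add_distrib, Finset.mul_sum] using h
    have hmul : ∀ (I : A) {v : ℕ → A} {a : A}, Tendsto v atTop (𝓝 a) →
        Tendsto (fun N => I * v N) atTop (𝓝 (I * a)) := fun I v a h =>
      ((LinearMap.mulLeft ℝ I).toContinuousLinearMap.continuous.tendsto a).comp h
    have hre : ∀ z, ‖spherePoly w z‖ < r ^ 2 →
        Tendsto (fun N => ∑ n ∈ Finset.range N, (S z n).re) atTop (𝓝 (F z).re) := by
      intro z hz
      have h := ((lim J hJ z hz).add (lim (-J) (neg_mem_imagUnits hJ) z hz)).const_smul (1 / 2 : ℝ)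
      refine h.congr fun N => ?_
      rw [neg_mul]; module
    have him : ∀ z, ‖spherePoly w z‖ < r ^ 2 →
        Tendsto (fun N => ∑ n ∈ Finset.range N, (S z n).im) atTop (𝓝 (F z).im) := by
      intro z hz
      have h := ((hmul J ((lim J hJ z hz).sub
        (lim (-J) (neg_mem_imagUnits hJ) z hz))).const_smul (1 / 2 : ℝ)).neg
      refine h.congr fun N => ?_
      rw [neg_mul, mul_sub, mul_add, mul_add, mul_neg, hneg hJ]; module
    refine ⟨r ^ 2, by positivity, fun I hI z hz => ?_, fun φ => ?_⟩
    · exact tendsto_nhds_unique (lim I hI z hz) ((hre z hz).add (hmul I (him z hz)))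
    · refine differentiableOn_of_tendsto_sphere_series (T := fun z n => functional φ (S z n))
        (fun z m => functional_sphStem_two_mul φ hJ w z m (s (2 * m)))
        (fun z m => functional_sphStem_two_mul_add_one φ hJ w z m (s (2 * m + 1))) fun z hz => ?_
      have hφ := φ.toContinuousLinearMap.continuous
      have h1 := (Complex.continuous_ofReal.tendsto _).comp ((hφ.tendsto _).comp (hre z hz))
      have h2 := (Complex.continuous_ofReal.tendsto _).comp ((hφ.tendsto _).comp (him z hz))
      refine (h1.add (h2.mul_const Complex.I)).congr fun N => ?_
      simp [functional, Finset.sum_add_distrib, Finset.sum_mul]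
  have hFd : ∀ φ : A →ₗ[ℝ] ℝ, DifferentiableOn ℂ (fun z => functional φ (F z)) D := by
    intro φ w hw
    obtain ⟨ρ, hρ, -, hd⟩ := loc w hw
    refine ((hd φ).differentiableAt ?_).differentiableWithinAt
    refine (isOpen_lt (differentiable_spherePoly w).continuous.norm continuous_const).mem_nhds ?_
    simpa [spherePoly_self] using hρ
  obtain ⟨h1, h2, h3⟩ := (forall_differentiableOn_functional_iff hD).1 hFd
  refine ⟨F, hstem, h1, h2, h3, ?_⟩
  intro x
  obtain ⟨z, I, hz, hI, e⟩ := x.2.2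
  obtain ⟨ρ, hρ, heq, -⟩ := loc z hz
  rw [← hg, e, sliceFun_apply hstem hz hI]
  exact heq I hI z (by simpa [spherePoly_self] using hρ)

end Equivalence

end SliceReg

open SliceReg
theorem mainTheorem2 {A : Type*} [NormedNonAssocRing A] [NormedSpace ℝ A]
    [IsScalarTower ℝ A A] [SMulCommClass ℝ A A] [StarRing A] [StarModule ℝ A]
    [FiniteDimensional ℝ A] [Nontrivial A]
    (halt : IsAlternative A) (hnorm : NormOnCone A)
    (D : Set ℂ) (hDopen : IsOpen D) (hDconj : ∀ z ∈ D, starRingEnd ℂ z ∈ D)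
    (hconn : IsConnected (circ A D)) (f : circ A D → A) :
    ((∀ t : ℝ, (t : ℂ) ∉ D) →
      (IsSliceRegular D f ↔ IsSlice D f ∧ IsSphericallyAnalytic D f)) ∧
    ((∃ t : ℝ, (t : ℂ) ∈ D) →
      (IsSliceRegular D f ↔ IsSphericallyAnalytic D f)) := by
  have hne : (imagUnits A).Nonempty := by
    obtain ⟨_, -, _, J, -, hJ, -⟩ := hconn.nonempty
    exact ⟨J, hJ⟩
  have key : IsSliceRegular D f ↔ IsSphericallyAnalytic D f :=
    ⟨fun h => h.isSphericallyAnalytic hnorm hDopen hDconj,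
      fun h => h.isSliceRegular halt hnorm hDopen hne⟩
  refine ⟨fun _ => ⟨fun h => ⟨?_, key.1 h⟩, fun h => key.2 h.2⟩, fun _ => key⟩
  obtain ⟨F, hF, -, -, -, hf⟩ := h
  exact ⟨F, hF, hf⟩
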